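/- All directed and undirected graphs below are finite and without self-loops (a directed graph may contain both $(u,v)$ and $(v,u)$). A node gadget consists of a number $k\ge 0$, an undirected graph $N$ on $\{1,\dots,k\}$ (the node graph) and a set $C\subseteq\{1,\dots,k\}^2$ of cross-edges; it is pictured as two copies of $N$, with an edge from node $i$ of the first copy to node $j$ of the second copy for each $(i,j)\in C$. Applied to a directed graph $G=(V,E)$ it yields the undirected graph $\rho(G)$ with node set $\{i_u : u\in V,\ 1\le i\le k\}$ and with the undirected edges $\{i_u,j_u\}$ for $u\in V$ and $\{i,j\}$ an edge of $N$, and $\{i_u,j_v\}$ for $(u,v)\in E$ and $(i,j)\in C$. The gadget is a reduction from directed to undirected Hamiltonian Cycle if, for every directed graph $G$, $G$ has a directed Hamiltonian cycle if and only if $\rho(G)$ has an undirected Hamiltonian cycle. (An undirected cycle has at least three nodes; a directed cycle of length $2$ is allowed; a graph without nodes or with a single node has no Hamiltonian cycle.) Write $P_C$ for the gadget with $k=3$ whose node graph is the path $1-2-3$ and whose set of cross-edges is $C$. A relabelling of a gadget permutes the nodes of the node graph, in the same way in both copies; exchanging the copies replaces $C$ by $\{(j,i) : (i,j)\in C\}$.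 **Proposition.** For a node gadget with $k\le 3$ the following are equivalent: 1. it is a reduction from directed to undirected Hamiltonian Cycle; 2. up to relabelling, it is one of the six gadgets $P_{\{(3,1)\}}$, $P_{\{(1,3)\}}$, $P_{\{(1,1),(3,1)\}}$, $P_{\{(1,1),(1,3)\}}$, $P_{\{(1,3),(3,3)\}}$, $P_{\{(3,1),(3,3)\}}$; 3. up to symmetry (relabelling, possibly after exchanging the two copies), it is one of the three gadgets $P_{\{(3,1)\}}$, $P_{\{(1,1),(3,1)\}}$, $P_{\{(1,1),(1,3)\}}$. Furthermore, a counterexample can be computed efficiently: there is a polynomial-time Turing machine that, given a node gadget with $k\le 3$ (encoded by $k$ in unary, the adjacency matrix of the node graph and the matrix of the cross-edges), outputs a directed graph $G$ (encoded by its number of nodes in unary and its adjacency matrix) such that, whenever the gadget is not a reduction, exactly one of the two statements "$G$ has a directed Hamiltonian cycle" and "$\rho(G)$ has an undirected Hamiltonian cycle" is true. -/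

import Mathlib

namespace NodeGadgets

/-- A node gadget. Both copies of the node graph have the node set `Fin k` and carry the graph
`nodeGraph`; a pair `(i, j) ∈ cross` is the cross-edge joining node `i` of the first copy to node
`j` of the second copy. -/
structure NodeGadget where
  k : ℕ
  nodeGraph : SimpleGraph (Fin k)
  cross : Set (Fin k × Fin k)

/-- The undirected graph obtained from the directed graph `G` by replacing each node `u` by a copy
`{u} × Fin k` of the node graph and inserting, for each edge `(u, v)` of `G`, the undirected edges
between `(u, i)` and `(v, j)` for all cross-edges `(i, j)`.
(`SimpleGraph.fromRel` is the symmetric closure without self-loops.) -/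
def NodeGadget.apply (g : NodeGadget) {V : Type} (G : Digraph V) : SimpleGraph (V × Fin g.k) :=
  SimpleGraph.fromRel fun p q =>
    (p.1 = q.1 ∧ g.nodeGraph.Adj p.2 q.2) ∨ (G.Adj p.1 q.1 ∧ (p.2, q.2) ∈ g.cross)

/-- A directed graph without self-loops. -/
def Loopless {V : Type} (G : Digraph V) : Prop :=
  ∀ v, ¬ G.Adj v v

/-- There is a directed Hamiltonian cycle: a cyclic enumeration of all nodes, without repetition,
such that each node has an edge to the next one (addition in `Fin (n + 1)` is modulo `n + 1`). -/
def HasDirectedHamCycle {V : Type} (G : Digraph V) : Prop :=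
  ∃ (n : ℕ) (f : Fin (n + 1) ≃ V), ∀ i, G.Adj (f i) (f (i + 1))

open Classical in
/-- There is an undirected Hamiltonian cycle. (Unlike `SimpleGraph.IsHamiltonian`, this does not
count the one-node graph as Hamiltonian.) -/
def HasUndirectedHamCycle {W : Type} (H : SimpleGraph W) : Prop :=
  ∃ (w : W) (p : H.Walk w w), p.IsHamiltonianCycle

/-- The gadget gives the same answer on `G` before and after it is applied. -/
def NodeGadget.CorrectOn (g : NodeGadget) {V : Type} (G : Digraph V) : Prop :=
  HasDirectedHamCycle G ↔ HasUndirectedHamCycle (g.apply G)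

/-- The gadget is a reduction from the directed to the undirected Hamiltonian cycle problem. -/
def NodeGadget.IsReduction (g : NodeGadget) : Prop :=
  ∀ (V : Type) [Finite V] (G : Digraph V), Loopless G → g.CorrectOn G

/-- `g` becomes `h` when the nodes of the node graph are relabelled, in the same way in both
copies. -/
def NodeGadget.Iso (g h : NodeGadget) : Prop :=
  ∃ e : Fin g.k ≃ Fin h.k,
    (∀ i j, g.nodeGraph.Adj i j ↔ h.nodeGraph.Adj (e i) (e j)) ∧
    (∀ i j, (i, j) ∈ g.cross ↔ (e i, e j) ∈ h.cross)

/-- The gadget with the two copies of the node graph exchanged. -/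
def NodeGadget.swap (g : NodeGadget) : NodeGadget where
  k := g.k
  nodeGraph := g.nodeGraph
  cross := {p | (p.2, p.1) ∈ g.cross}

/-- `g` and `h` agree up to relabelling and up to exchanging the two copies. -/
def NodeGadget.Symmetric (g h : NodeGadget) : Prop :=
  g.Iso h ∨ g.swap.Iso h

/-- The gadget whose node graph is the path `0 - 1 - 2`, with the given cross-edges. -/
def pathGadget (C : Set (Fin 3 × Fin 3)) : NodeGadget where
  k := 3
  nodeGraph := SimpleGraph.pathGraph 3
  cross := C

/-- The six valid gadgets. -/
def sixGadgets : Set NodeGadget :=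
  {pathGadget {(2, 0)}, pathGadget {(0, 2)},
   pathGadget {(0, 0), (2, 0)}, pathGadget {(0, 0), (0, 2)},
   pathGadget {(0, 2), (2, 2)}, pathGadget {(2, 0), (2, 2)}}

/-- The three valid gadgets up to symmetry. -/
def threeGadgets : Set NodeGadget :=
  {pathGadget {(2, 0)}, pathGadget {(0, 0), (2, 0)}, pathGadget {(0, 0), (0, 2)}}

/-- A gadget whose node graph has at most three nodes. -/
def SmallGadget : Type := {g : NodeGadget // g.k ≤ 3}

/-- A directed graph without self-loops on the node set `Fin n`, as an object that an algorithm can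
output. -/
structure FiniteDigraph where
  n : ℕ
  graph : Digraph (Fin n)
  loopless : Loopless graph

open Classical in
/-- The `n × n` table of a binary relation, row by row. -/
noncomputable def encodeTable {n : ℕ} (R : Fin n → Fin n → Prop) : List Bool :=
  (List.finRange n).flatMap fun i => (List.finRange n).map fun j => decide (R i j)

/-- Unary `n`, a delimiter, and the adjacency matrix. -/
noncomputable def encodeDigraph (G : FiniteDigraph) : List Bool :=
  List.replicate G.n true ++ [false] ++ encodeTable G.graph.Adj

/-- Unary `k`, a delimiter, the adjacency matrix of the node graph, and the matrix of the
cross-edges. -/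
noncomputable def encodeGadget (g : SmallGadget) : List Bool :=
  List.replicate g.1.k true ++ [false] ++ encodeTable g.1.nodeGraph.Adj ++
    encodeTable fun i j => (i, j) ∈ g.1.cross

end NodeGadgets

namespace NodeGadgets

/-! ## Hamiltonian cycles as orbits and as lists -/

/-! Correctness. If `(2, 0) ∈ C`, a directed Hamiltonian cycle lifts: run through each copy as 0, 1,
2 and jump along the cross-edge to the next copy. Conversely let `C ⊆ {(0, 0), (2, 0)}`. The middle
node of a copy has no neighbours outside its copy, so an undirected Hamiltonian cycle traverses
every copy as a block, either 0, 1, 2 or backwards. Leaving a copy at node 2 is possible only along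
an edge of `G`, into node 0 of the next copy, which is then traversed forwards too. Hence, after a
choice of orientation, all copies are traversed forwards, (0, 0)-edges are never used, and the order
of the copies is a directed Hamiltonian cycle. Exchanging the copies amounts to reversing `G`, and
reversing the path 0 - 1 - 2 relates the remaining gadgets.

Completeness. Gadgets with at most three nodes are finitely many bit vectors, and three test graphs
refute all invalid ones: `point` (the node graph is a triangle), `twoCycle` (Hamiltonian, but its
image is not) and `fourNode` (not Hamiltonian, but its image is). Adding edges preserves
Hamiltonicity, so `fourNode` needs only a short list of edge sets that suffice for a cycle, each
with an explicit cycle; `twoCycle` needs a search without result. The kernel evaluates both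
(`hamCodes2_check`, `hamCodes3_check`).

Computability. There are finitely many inputs, of bounded length, so the counterexamples form a
table hard-wired into a machine. -/

open Fin.CommRing in
theorem hasDirectedHamCycle_iff_iterate {V : Type} {G : Digraph V} :
    HasDirectedHamCycle G ↔
      Nonempty V ∧ ∃ s : V → V, (∀ x, G.Adj x (s x)) ∧ ∀ x y, ∃ n : ℕ, s^[n] x = y := by
  constructor
  · rintro ⟨n, f, hf⟩
    refine ⟨⟨f 0⟩, fun x => f (f.symm x + 1), fun x => by simpa using hf (f.symm x), ?_⟩
    have key : ∀ (m : ℕ) (x : V),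
        (fun x => f (f.symm x + 1))^[m] x = f (f.symm x + (m : Fin (n + 1))) := by
      intro m
      induction m with
      | zero => simp
      | succ m ih =>
        intro x
        rw [Function.iterate_succ_apply', ih]
        simp [add_assoc]
    intro x y
    refine ⟨(f.symm y - f.symm x).val, ?_⟩
    rw [key]
    simp
  · rintro ⟨⟨a⟩, s, hs, htrans⟩
    obtain ⟨m, hm⟩ := htrans (s a) a
    have hper : a ∈ Function.periodicPts s := ⟨m + 1, m.succ_pos, hm⟩
    obtain ⟨n, hn⟩ := Nat.exists_eq_succ_of_ne_zero
      (Function.minimalPeriod_pos_of_mem_periodicPts hper).ne'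
    have hbij : Function.Bijective fun i : Fin (n + 1) => s^[i] a := by
      constructor
      · intro i j hij
        exact Fin.ext (Function.iterate_injOn_Iio_minimalPeriod
          (by simpa [hn] using i.is_lt) (by simpa [hn] using j.is_lt) hij)
      · intro y
        obtain ⟨k, rfl⟩ := htrans a y
        refine ⟨⟨k % (n + 1), Nat.mod_lt _ n.succ_pos⟩, ?_⟩
        simpa [hn] using Function.iterate_mod_minimalPeriod_eq (f := s) (x := a) (n := k)
    refine ⟨n, Equiv.ofBijective _ hbij, fun i => ?_⟩
    have hi : s^[(i + 1 : Fin (n + 1)).val] a = s (s^[i] a) := by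
      rw [← Function.iterate_succ_apply' s, Fin.val_add_one]
      split_ifs with h
      · subst h
        have := Function.iterate_minimalPeriod (f := s) (x := a)
        rw [hn] at this
        simpa using this.symm
      · rfl
    simpa [hi] using hs (s^[i] a)

/-- Reduces undirected cycles to directed ones in the symmetric digraph. The bound 3 excludes going
back and forth along one edge; it also forces `W` to be finite, as `Nat.card` of an infinite type is
0. -/
theorem hasUndirectedHamCycle_iff {W : Type} {H : SimpleGraph W} :
    HasUndirectedHamCycle H ↔
      3 ≤ Nat.card W ∧ HasDirectedHamCycle (⟨H.Adj⟩ : Digraph W) := by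
  classical
  constructor
  · rintro ⟨w, p, hp⟩
    have : Finite W := hp.finite
    have := Fintype.ofFinite W
    have hlen := hp.length_eq
    have h3 : 3 ≤ p.length := hp.isCycle.three_le_length
    have htail := SimpleGraph.Walk.length_tail_add_one hp.isCycle.not_nil
    refine ⟨by rw [Nat.card_eq_fintype_card]; omega, p.tail.length,
      (finCongr p.tail.length_support.symm).trans hp.isHamiltonian_tail.getVertEquiv, ?_⟩
    intro i
    have hi : ∀ i : Fin (p.tail.length + 1), ((finCongr p.tail.length_support.symm).trans
        hp.isHamiltonian_tail.getVertEquiv) i = p.getVert (i + 1) := by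
      intro i
      simp [SimpleGraph.Walk.getVert_tail]
    simp only [hi]
    rw [Fin.val_add_one]
    -- The enumeration starts at the second node of the walk, so the last index gives `w`, and the
    -- closing edge is the first edge of the walk.
    split_ifs with h
    · subst h
      have h0 := p.adj_getVert_succ (i := 0) (by omega)
      have hw : p.getVert (p.tail.length + 1) = w := by rw [htail, p.getVert_length]
      rw [Fin.val_last, hw]
      simpa using h0
    · exact p.adj_getVert_succ (by
        have : i.val ≠ p.tail.length := fun h' => h (Fin.ext h')
        omega)
  · rintro ⟨h3, n, f, hf⟩
    have := Fintype.ofEquiv _ f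
    have hcard : Fintype.card W = n + 1 := by simp [← Fintype.card_congr f]
    rw [Nat.card_eq_fintype_card] at h3
    obtain ⟨n, rfl⟩ : ∃ m, n = m + 2 := ⟨n - 2, by omega⟩
    have hc : (SimpleGraph.cycleGraph (n + 3)).IsContained H := by
      refine ⟨⟨⟨f, ?_⟩, f.injective⟩⟩
      intro u v huv
      rw [SimpleGraph.cycleGraph_adj] at huv
      rcases huv with h | h
      · rw [sub_eq_iff_eq_add'.mp h]
        simpa [add_comm] using (hf v).symm
      · rw [sub_eq_iff_eq_add'.mp h]
        simpa [add_comm] using hf u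
    obtain ⟨v, p, hp, hl⟩ := (SimpleGraph.cycleGraph_isContained_iff (by omega)).mp hc
    exact ⟨v, p, SimpleGraph.Walk.isHamiltonianCycle_iff_isCycle_and_length_eq.mpr
      ⟨hp, by rw [hl, hcard]⟩⟩

theorem HasDirectedHamCycle.of_iso {V W : Type} {G : Digraph V} {H : Digraph W} (e : V ≃ W)
    (h : ∀ x y, G.Adj x y → H.Adj (e x) (e y)) (hG : HasDirectedHamCycle G) :
    HasDirectedHamCycle H := by
  obtain ⟨n, f, hf⟩ := hG
  exact ⟨n, f.trans e, fun i => h _ _ (hf i)⟩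

theorem HasUndirectedHamCycle.of_iso {V W : Type} {G : SimpleGraph V} {H : SimpleGraph W}
    (e : V ≃ W) (h : ∀ x y, G.Adj x y → H.Adj (e x) (e y)) (hG : HasUndirectedHamCycle G) :
    HasUndirectedHamCycle H := by
  rw [hasUndirectedHamCycle_iff] at hG ⊢
  exact ⟨Nat.card_congr e ▸ hG.1, hG.2.of_iso e h⟩

theorem HasDirectedHamCycle.reverse {V : Type} {G H : Digraph V}
    (h : ∀ x y, G.Adj x y → H.Adj y x) (hG : HasDirectedHamCycle G) :
    HasDirectedHamCycle H := by
  obtain ⟨n, f, hf⟩ := hG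
  refine ⟨n, (Equiv.neg _).trans f, fun i => ?_⟩
  have := h _ _ (hf (-(i + 1)))
  simpa [neg_add_rev] using this

/-- The list `a :: t` enumerates all elements without repetition, and each of them is related to
the next one, the last one to `a`. -/
def IsHamList {V : Type} (A : V → V → Bool) (a : V) (t : List V) : Prop :=
  (a :: t ++ [a]).IsChain (A · ·) ∧ (a :: t).Nodup ∧ ∀ x, x ∈ a :: t

instance {V : Type} [Fintype V] [DecidableEq V] (A : V → V → Bool) (a : V) (t : List V) :
    Decidable (IsHamList A a t) :=
  inferInstanceAs (Decidable (_ ∧ _ ∧ _))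

theorem IsHamList.hasDirectedHamCycle {V : Type} {A : V → V → Bool} {a : V} {t : List V}
    (h : IsHamList A a t) : HasDirectedHamCycle (⟨fun x y => A x y⟩ : Digraph V) := by
  classical
  obtain ⟨hch, hnd, hall⟩ := h
  refine ⟨t.length, hnd.getEquivOfForallMemList _ hall, fun i => ?_⟩
  rw [List.isChain_iff_getElem] at hch
  have hi := hch i (by simp; omega)
  simp only [List.Nodup.getEquivOfForallMemList, Equiv.coe_fn_mk, List.get_eq_getElem]
  convert hi using 2
  · rw [List.getElem_append_left]
  · have := Fin.val_add_one i
    split_ifs at this with h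
    · subst h
      simp
    · rw [List.getElem_append_left (by have := (i + 1).is_lt; simp_all)]
      simp only [this]

/-- Searches for an enumeration of the list that starts with a successor of `v`, ends with `a`,
and in which each node has an edge to the next one. The first argument is the length of the
list. -/
def pathSearch {V : Type} [DecidableEq V] (A : V → V → Bool) (a : V) : ℕ → V → List V → Bool
  | 0, v, _ => v == a
  | n + 1, v, r => r.any fun w => A v w && pathSearch A a n w (r.erase w)

theorem pathSearch_eq_true {V : Type} [DecidableEq V] {A : V → V → Bool} {a : V} (t : List V) :
    ∀ {v : V} {r : List V}, t.Perm r → (v :: t).IsChain (A · ·) →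
      (v :: t).getLast (List.cons_ne_nil _ _) = a → pathSearch A a t.length v r = true := by
  induction t with
  | nil =>
    intro v r _ _ h
    simpa [pathSearch] using h
  | cons w t ih =>
    intro v r hp hc hl
    rw [List.isChain_cons_cons] at hc
    simp only [List.length_cons, pathSearch, List.any_eq_true, Bool.and_eq_true]
    refine ⟨w, hp.subset (by simp), hc.1, ih ?_ hc.2 (by simpa using hl)⟩
    exact List.cons_perm_iff_perm_erase.mp hp |>.2

theorem not_hasDirectedHamCycle_of_pathSearch {V : Type} [DecidableEq V] {A : V → V → Bool}
    (r : List V) (hnd : r.Nodup) (hr : ∀ x, x ∈ r) (a : V)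
    (h : pathSearch A a r.length a r = false) :
    ¬ HasDirectedHamCycle (⟨fun x y => A x y⟩ : Digraph V) := by
  rintro ⟨n, f, hf⟩
  -- The cycle is rotated so that it starts just after `a` and ends with `a`, as the search expects.
  set g : Fin (n + 1) → V := fun i => f (f.symm a + i + 1) with hg
  have hinj : Function.Injective g := fun i j hij => by simpa [hg] using hij
  have hp : (List.ofFn g).Perm r := by
    rw [List.perm_ext_iff_of_nodup (List.nodup_ofFn.mpr hinj) hnd]
    intro x
    simp only [hr, iff_true, List.mem_ofFn]
    exact ⟨f.symm x - f.symm a - 1, by simp [hg, add_assoc]⟩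
  have hs : pathSearch A a (List.ofFn g).length a r = true := by
    refine pathSearch_eq_true _ hp ?_ ?_
    · rw [List.isChain_iff_getElem]
      intro i hi
      rcases i with _ | i
      · simpa [hg] using hf (f.symm a)
      · have hi' : i + 1 < n + 1 := by simpa using hi
        have := hf (f.symm a + ⟨i, by omega⟩ + 1)
        have he : (⟨i, by omega⟩ : Fin (n + 1)) + 1 = ⟨i + 1, hi'⟩ := by
          ext
          rw [Fin.val_add_one_of_lt]
          simp [Fin.lt_def]
          omega
        simp only [List.getElem_cons_succ, List.getElem_ofFn, hg]
        rw [← he, ← add_assoc]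
        exact this
    · rw [List.getLast_cons (by simp), List.getLast_ofFn]
      simp only [hg]
      have : (⟨n + 1 - 1, by omega⟩ : Fin (n + 1)) + 1 = 0 := by
        ext; simp [Fin.val_add]
      rw [add_assoc, this]
      simp
  rw [hp.length_eq] at hs
  simp [hs] at h

/-! ## Symmetries of gadgets -/

theorem NodeGadget.apply_adj {g : NodeGadget} {V : Type} {G : Digraph V} {p q : V × Fin g.k} :
    (g.apply G).Adj p q ↔ p ≠ q ∧
      (((p.1 = q.1 ∧ g.nodeGraph.Adj p.2 q.2) ∨ (G.Adj p.1 q.1 ∧ (p.2, q.2) ∈ g.cross)) ∨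
        ((q.1 = p.1 ∧ g.nodeGraph.Adj q.2 p.2) ∨ (G.Adj q.1 p.1 ∧ (q.2, p.2) ∈ g.cross))) :=
  SimpleGraph.fromRel_adj _ _ _

theorem NodeGadget.Iso.symm {g h : NodeGadget} (i : g.Iso h) : h.Iso g := by
  obtain ⟨e, h1, h2⟩ := i
  exact ⟨e.symm, fun i j => by simp [h1], fun i j => by simp [h2]⟩

theorem NodeGadget.Iso.trans {g h l : NodeGadget} (i : g.Iso h) (j : h.Iso l) : g.Iso l := by
  obtain ⟨e, h1, h2⟩ := i
  obtain ⟨f, h3, h4⟩ := j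
  exact ⟨e.trans f, fun i j => by simp [h1, h3], fun i j => by simp [h2, h4]⟩

theorem NodeGadget.Iso.hasUndirectedHamCycle {g h : NodeGadget} (i : g.Iso h) {V : Type}
    {G : Digraph V} (hG : HasUndirectedHamCycle (g.apply G)) :
    HasUndirectedHamCycle (h.apply G) := by
  obtain ⟨e, h1, h2⟩ := i
  refine hG.of_iso (Equiv.prodCongr (Equiv.refl V) e) fun x y hxy => ?_
  rw [NodeGadget.apply_adj] at hxy ⊢
  simpa [← h1, ← h2, Prod.ext_iff] using hxy

theorem NodeGadget.Iso.correctOn_iff {g h : NodeGadget} (i : g.Iso h) {V : Type}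
    {G : Digraph V} : g.CorrectOn G ↔ h.CorrectOn G :=
  iff_congr Iff.rfl ⟨i.hasUndirectedHamCycle, i.symm.hasUndirectedHamCycle⟩

theorem NodeGadget.Iso.isReduction {g h : NodeGadget} (i : g.Iso h) (hh : h.IsReduction) :
    g.IsReduction :=
  fun V _ G hG => i.correctOn_iff.mpr (hh V G hG)

/-- Applying the exchanged gadget to `G` is applying the original one to the reversed graph, and
reversal preserves Hamiltonicity. -/
theorem NodeGadget.IsReduction.swap {g : NodeGadget} (hg : g.IsReduction) :
    g.swap.IsReduction := by
  intro V _ G hG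
  have h := hg V (⟨fun x y => G.Adj y x⟩ : Digraph V) hG
  have h1 : HasDirectedHamCycle G ↔ HasDirectedHamCycle (⟨fun x y => G.Adj y x⟩ : Digraph V) :=
    ⟨fun h => h.reverse fun _ _ => id, fun h => h.reverse fun _ _ => id⟩
  have h2 : g.swap.apply G = g.apply (⟨fun x y => G.Adj y x⟩ : Digraph V) := by
    ext p q
    refine NodeGadget.apply_adj.trans (Iff.trans ?_ NodeGadget.apply_adj.symm)
    have h1 := g.nodeGraph.adj_comm p.2 q.2
    have h2 : p.1 = q.1 ↔ q.1 = p.1 := eq_comm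
    change (p ≠ q ∧ ((_ ∨ (_ ∧ (q.2, p.2) ∈ g.cross)) ∨ (_ ∨ (_ ∧ (p.2, q.2) ∈ g.cross)))) ↔ _
    tauto
  rw [NodeGadget.CorrectOn, h1, h2]
  exact h

/-! ## The valid gadgets -/

theorem not_hasDirectedHamCycle_of_subsingleton {V : Type} [Subsingleton V] {G : Digraph V}
    (hG : Loopless G) : ¬ HasDirectedHamCycle G := by
  rintro ⟨n, f, hf⟩
  have := hf 0
  rw [Subsingleton.elim (f (0 + 1)) (f 0)] at this
  exact hG _ this

/-- The graph that the gadget `pathGadget C` yields, on the node set `V × Fin 3`. -/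
def pathApply (C : Set (Fin 3 × Fin 3)) {V : Type} (G : Digraph V) : SimpleGraph (V × Fin 3) :=
  (pathGadget C).apply G

theorem pathApply_adj {C : Set (Fin 3 × Fin 3)} {V : Type} {G : Digraph V} {x y : V}
    {i j : Fin 3} :
    (pathApply C G).Adj (x, i) (y, j) ↔ (x, i) ≠ (y, j) ∧
      ((x = y ∧ (i.val + 1 = j ∨ j.val + 1 = i)) ∨ (G.Adj x y ∧ (i, j) ∈ C) ∨
        (G.Adj y x ∧ (j, i) ∈ C)) := by
  refine NodeGadget.apply_adj.trans ?_
  have h1 : x = y ↔ y = x := eq_comm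
  change (_ ∧ ((_ ∧ (SimpleGraph.pathGraph 3).Adj _ _ ∨ _) ∨
    (_ ∧ (SimpleGraph.pathGraph 3).Adj _ _ ∨ _))) ↔ _
  simp only [SimpleGraph.pathGraph_adj]
  change (_ ∧ ((_ ∨ _ ∧ (i, j) ∈ C) ∨ _ ∨ _ ∧ (j, i) ∈ C)) ↔ _
  tauto

theorem hasUndirectedHamCycle_pathGadget {C : Set (Fin 3 × Fin 3)} (hC : (2, 0) ∈ C) {V : Type}
    {G : Digraph V} (hL : Loopless G) (hG : HasDirectedHamCycle G) :
    HasUndirectedHamCycle (pathApply C G) := by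
  have hV : Finite V := by
    obtain ⟨n, f, -⟩ := hG
    exact Finite.of_equiv _ f
  obtain ⟨⟨a⟩, s, hs, htrans⟩ := hasDirectedHamCycle_iff_iterate.mp hG
  have : Nonempty V := ⟨a⟩
  set σ : V × Fin 3 → V × Fin 3 := fun p => if p.2 = 2 then (s p.1, 0) else (p.1, p.2 + 1)
  refine hasUndirectedHamCycle_iff.mpr ⟨?_, hasDirectedHamCycle_iff_iterate.mpr
    ⟨⟨((a, 0) : V × Fin 3)⟩, σ, ?_, ?_⟩⟩
  · rw [Nat.card_prod, Nat.card_fin]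
    have := Nat.card_pos (α := V)
    omega
  · dsimp only
    rintro ⟨x, i⟩
    have hne : x ≠ s x := fun h => hL x (by simpa [← h] using hs x)
    fin_cases i
    · exact pathApply_adj.mpr (by simp)
    · exact pathApply_adj.mpr (by simp)
    · exact pathApply_adj.mpr (by simp [hs, hC, hne])
  -- Three steps of `σ` from a node 0 make one step of `s`. A general orbit goes on to the next node
  -- 0, then to the right copy, then to the right node within it.
  · have h1 : ∀ n x, σ^[3 * n] (x, 0) = (s^[n] x, 0) := by
      intro n
      induction n with
      | zero => simp
      | succ n ih =>
        intro x
        rw [mul_add, mul_one, Function.iterate_add_apply]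
        have : σ^[3] (x, 0) = (s x, 0) := by simp [σ]
        rw [this, ih, Function.iterate_succ_apply]
    have h2 : ∀ p : V × Fin 3, ∃ n y, σ^[n] p = (y, 0) := by
      rintro ⟨x, i⟩
      refine ⟨3 - i, s x, ?_⟩
      fin_cases i <;> simp [σ]
    have h3 : ∀ (x : V) (i : Fin 3), ∃ n, σ^[n] (x, 0) = (x, i) := by
      intro x i
      refine ⟨i, ?_⟩
      fin_cases i <;> simp [σ]
    rintro p ⟨y, i⟩
    obtain ⟨n, x, hx⟩ := h2 p
    obtain ⟨m, hm⟩ := htrans x y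
    obtain ⟨l, hl⟩ := h3 y i
    exact ⟨l + (3 * m + n), by
      rw [Function.iterate_add_apply, Function.iterate_add_apply, hx, h1, hm, hl]⟩

theorem HasUndirectedHamCycle.exists_perm {W : Type} {H : SimpleGraph W}
    (hH : HasUndirectedHamCycle H) :
    ∃ σ : Equiv.Perm W, (∀ x, H.Adj x (σ x)) ∧ (∀ x, σ (σ x) ≠ x) ∧
      ∀ x y, ∃ n : ℕ, σ^[n] x = y := by
  obtain ⟨h3, hG⟩ := hasUndirectedHamCycle_iff.mp hH
  obtain ⟨-, s, hs, htrans⟩ := hasDirectedHamCycle_iff_iterate.mp hG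
  have : Finite W := Nat.finite_of_card_ne_zero (by omega)
  have hsurj : Function.Surjective s := by
    intro y
    obtain ⟨n, hn⟩ := htrans (s y) y
    exact ⟨s^[n] y, by rw [← Function.iterate_succ_apply' s, Function.iterate_succ_apply, hn]⟩
  refine ⟨Equiv.ofBijective s hsurj.bijective_of_finite, hs, fun x hx => ?_, htrans⟩
  change s (s x) = x at hx
  -- If `s` returned to `x` after two steps, the single orbit would have at most two elements.
  have horb : ∀ n : ℕ, s^[n] x = x ∨ s^[n] x = s x := by
    intro n
    induction n with
    | zero => simp
    | succ n ih =>
      rw [Function.iterate_succ_apply']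
      rcases ih with h | h <;> simp [h, hx]
  have := Fintype.ofFinite W
  classical
  have hle : (Finset.univ : Finset W) ⊆ {x, s x} := by
    intro y _
    obtain ⟨n, rfl⟩ := htrans x y
    simpa using horb n
  have := (Finset.card_le_card hle).trans Finset.card_le_two
  rw [Finset.card_univ, ← Nat.card_eq_fintype_card] at this
  omega

/-- The hypothesis `ha` fixes the orientation: one copy is traversed forwards. This property passes
from each copy to the next one, and so to all of them. -/
theorem hasDirectedHamCycle_of_perm {C : Set (Fin 3 × Fin 3)} (hC : C ⊆ {(0, 0), (2, 0)})
    {V : Type} {G : Digraph V} (σ : Equiv.Perm (V × Fin 3))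
    (hadj : ∀ p, (pathApply C G).Adj p (σ p)) (hne : ∀ p, σ (σ p) ≠ p)
    (htrans : ∀ p q, ∃ n : ℕ, σ^[n] p = q) (a : V) (ha : σ (a, 1) = (a, 2)) :
    HasDirectedHamCycle G := by
  have hC' : ∀ i j, (i, j) ∈ C → j = 0 ∧ (i = 0 ∨ i = 2) := by
    intro i j h
    have := hC h
    simp only [Set.mem_insert_iff, Set.mem_singleton_iff, Prod.mk.injEq] at this
    tauto
  have hmid : ∀ x q, (pathApply C G).Adj (x, 1) q → q = (x, 0) ∨ q = (x, 2) := by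
    rintro x ⟨y, j⟩ h
    obtain ⟨-, ⟨rfl, hj⟩ | ⟨-, h⟩ | ⟨-, h⟩⟩ := pathApply_adj.mp h
    · fin_cases j <;> simp at hj ⊢
    · have := hC' _ _ h; simp at this
    · have := hC' _ _ h; simp at this
  have hlast : ∀ x q, (pathApply C G).Adj (x, 2) q →
      q = (x, 1) ∨ ∃ y, q = (y, 0) ∧ G.Adj x y := by
    rintro x ⟨y, j⟩ h
    obtain ⟨-, ⟨rfl, hj⟩ | ⟨h', h⟩ | ⟨-, h⟩⟩ := pathApply_adj.mp h
    · fin_cases j <;> simp at hj ⊢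
    · exact Or.inr ⟨y, by rw [(hC' _ _ h).1], h'⟩
    · have := hC' _ _ h; simp at this
  have hfirst : ∀ x, σ (x, 1) = (x, 2) → σ (x, 0) = (x, 1) := by
    intro x hx
    obtain ⟨q, hq⟩ := σ.surjective (x, 1)
    rcases hmid x q (hq ▸ (hadj q).symm) with rfl | rfl
    · exact hq
    · exact absurd (by rw [hq, hx]) (hne (x, 2))
  have hnext : ∀ x, σ (x, 1) = (x, 2) → ∃ y, σ (x, 2) = (y, 0) ∧ G.Adj x y ∧ σ (y, 1) = (y, 2) := by
    intro x hx
    rcases hlast x _ (hadj (x, 2)) with h | ⟨y, h, hy⟩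
    · exact absurd (by rw [hx, h]) (hne (x, 1))
    · refine ⟨y, h, hy, ?_⟩
      rcases hmid y _ (hadj (y, 1)) with h' | h'
      -- If copy `y` were traversed backwards, `(y, 0)` would have both `(x, 2)` and `(y, 1)` as
      -- predecessor.
      · have := σ.injective (h.trans h'.symm)
        simp at this
      · exact h'
  have hall : ∀ x, σ (x, 1) = (x, 2) := by
    intro x
    have hstep : ∀ n : ℕ, ∃ y i, σ^[n] (a, 0) = (y, i) ∧ σ (y, 1) = (y, 2) := by
      intro n
      induction n with
      | zero => exact ⟨a, 0, rfl, ha⟩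
      | succ n ih =>
        obtain ⟨y, i, hn, hy⟩ := ih
        rw [Function.iterate_succ_apply', hn]
        obtain ⟨z, hz, -, hz'⟩ := hnext y hy
        fin_cases i
        · exact ⟨y, 1, hfirst y hy, hy⟩
        · exact ⟨y, 2, hy, hy⟩
        · exact ⟨z, 0, hz, hz'⟩
    obtain ⟨n, hn⟩ := htrans (a, 0) (x, 0)
    obtain ⟨y, i, h, hy⟩ := hstep n
    rw [hn] at h
    cases h
    exact hy
  choose s hs hGs _ using fun x => hnext x (hall x)
  refine hasDirectedHamCycle_iff_iterate.mpr ⟨⟨a⟩, s, hGs, fun x y => ?_⟩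
  -- Projected to `V`, an orbit of `σ` stands still or follows `s`; hence `s` inherits transitivity
  -- from `σ`.
  have hstep : ∀ n : ℕ, ∃ m : ℕ, (σ^[n] (x, 0)).1 = s^[m] x := by
    intro n
    induction n with
    | zero => exact ⟨0, rfl⟩
    | succ n ih =>
      obtain ⟨m, hm⟩ := ih
      rw [Function.iterate_succ_apply']
      generalize σ^[n] (x, 0) = p at hm
      obtain ⟨z, i⟩ := p
      dsimp only at hm
      fin_cases i
      · exact ⟨m, by simpa [hfirst z (hall z)] using hm⟩
      · exact ⟨m, by simpa [hall z] using hm⟩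
      · exact ⟨m + 1, by simp [hs, Function.iterate_succ_apply', hm]⟩
  obtain ⟨n, hn⟩ := htrans (x, 0) (y, 0)
  obtain ⟨m, hm⟩ := hstep n
  exact ⟨m, by rw [← hm, hn]⟩

theorem hasDirectedHamCycle_of_pathGadget {C : Set (Fin 3 × Fin 3)}
    (hC : C ⊆ {(0, 0), (2, 0)}) {V : Type} {G : Digraph V}
    (hG : HasUndirectedHamCycle (pathApply C G)) : HasDirectedHamCycle G := by
  obtain ⟨⟨a, i⟩, -⟩ := id hG
  obtain ⟨σ, hadj, hne, htrans⟩ := hG.exists_perm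
  have hmid : ∀ q : V × Fin 3, (pathApply C G).Adj (a, (1 : Fin 3)) q →
      q = (a, 0) ∨ q = (a, 2) := by
    rintro ⟨y, j⟩ h
    obtain ⟨-, ⟨rfl, hj⟩ | ⟨-, h⟩ | ⟨-, h⟩⟩ := pathApply_adj.mp h
    · fin_cases j <;> simp at hj ⊢
    · simpa using hC h
    · simpa using hC h
  rcases hmid _ (hadj _) with h | h
  · obtain ⟨q, hq⟩ := σ.surjective (a, 1)
    rcases hmid q (hq ▸ (hadj q).symm) with rfl | rfl
    · exact absurd (by rw [hq, h]) (hne (a, (0 : Fin 3)))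
    -- Here copy `a` is traversed as 2, 1, 0, so the cycle is run in the opposite direction.
    · refine hasDirectedHamCycle_of_perm hC σ⁻¹ (fun p => ?_) (fun p hp => hne p ?_)
        (fun p q => ?_) a (by rw [← hq]; simp)
      · have := (hadj (σ⁻¹ p)).symm
        rwa [← Equiv.Perm.mul_apply, mul_inv_cancel, Equiv.Perm.one_apply] at this
      · have := congrArg (fun x => σ (σ x)) hp
        simpa using this.symm
      · obtain ⟨n, hn⟩ := htrans q p
        refine ⟨n, ?_⟩
        have hl : Function.LeftInverse (σ⁻¹ : Equiv.Perm (V × Fin 3)) σ := fun x => by simp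
        rw [← hn]
        exact hl.iterate n q
  · exact hasDirectedHamCycle_of_perm hC σ hadj hne htrans a h

theorem isReduction_pathGadget {C : Set (Fin 3 × Fin 3)} (h : (2, 0) ∈ C)
    (hC : C ⊆ {(0, 0), (2, 0)}) : (pathGadget C).IsReduction :=
  fun _ _ _ hL => ⟨hasUndirectedHamCycle_pathGadget h hL, hasDirectedHamCycle_of_pathGadget hC⟩

/-! ## Gadgets as bit vectors -/

/-- The edges of the node graph are read from the lowest three bits of the code: the edge between
`i` and `j` from bit `i + j - 1`. -/
def nodeBit (c : ℕ) {k : ℕ} (i j : Fin k) : Bool :=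
  i != j && c.testBit (i + j - 1)

theorem nodeBit_comm (c : ℕ) {k : ℕ} (i j : Fin k) : nodeBit c i j = nodeBit c j i := by
  rw [nodeBit, nodeBit, bne_comm, add_comm]

/-- The cross-edges are read from the remaining bits, row by row. -/
def crossBit (c : ℕ) {k : ℕ} (i j : Fin k) : Bool :=
  c.testBit (3 + k * i + j)

/-- The gadget with the given code. -/
def ofCode (k c : ℕ) : NodeGadget where
  k := k
  nodeGraph :=
    { Adj := fun i j => nodeBit c i j
      symm := ⟨fun i j h => (nodeBit_comm c i j).symm.trans h⟩
      loopless := ⟨fun i h => by simp [nodeBit] at h⟩ }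
  cross := {p | crossBit c p.1 p.2}

/-- The bound on `g.k` matters for the node graph: for distinct indices below 3, the number `i + j -
1` is one of 0, 1, 2 and determines the unordered pair. -/
theorem exists_eq_ofCode (g : NodeGadget) (hk : g.k ≤ 3) :
    ∃ c < 2 ^ (3 + g.k * g.k), g = ofCode g.k c := by
  classical
  obtain ⟨k, N, C⟩ := g
  dsimp only at hk ⊢
  let P : ℕ → Bool := fun b =>
    decide ((b < 3 ∧ ∃ i j : Fin k, N.Adj i j ∧ i.val + j - 1 = b) ∨
      ∃ p ∈ C, 3 + k * p.1.val + p.2 = b)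
  have hP : ∀ b < 3 + k * k,
      (Nat.ofBits fun b : Fin (3 + k * k) => P b).testBit b = P b := fun b hb => by
    rw [Nat.testBit_ofBits_lt _ _ hb]
  refine ⟨Nat.ofBits fun b : Fin (3 + k * k) => P b, Nat.ofBits_lt_two_pow _, ?_⟩
  generalize (Nat.ofBits fun b : Fin (3 + k * k) => P b) = c at hP
  have hN : ∀ i j : Fin k, N.Adj i j ↔ nodeBit c i j = true := by
    intro i j
    by_cases hij : i = j
    · subst hij
      simp [nodeBit]
    have hij' : i.val ≠ j := fun h => hij (Fin.ext h)
    have hb : i.val + j - 1 < 3 := by omega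
    simp only [nodeBit, hP _ (show i.val + j - 1 < 3 + k * k by omega), Bool.and_eq_true,
      bne_iff_ne, ne_eq, hij, not_false_eq_true, true_and, P, decide_eq_true_eq, hb]
    constructor
    · exact fun h => Or.inl ⟨i, j, h, rfl⟩
    · rintro (⟨i', j', h, h'⟩ | ⟨p, -, h⟩)
      · have hne : i'.val ≠ j' := fun h' => h.ne (Fin.ext h')
        have : (i' = i ∧ j' = j) ∨ (i' = j ∧ j' = i) := by
          simp only [Fin.ext_iff]
          omega
        rcases this with ⟨rfl, rfl⟩ | ⟨rfl, rfl⟩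
        · exact h
        · exact h.symm
      · omega
  have hC : ∀ p : Fin k × Fin k, p ∈ C ↔ crossBit c p.1 p.2 = true := by
    rintro ⟨i, j⟩
    have hlt : 3 + k * i.val + j < 3 + k * k := by
      have : k * i.val + k ≤ k * k := by
        rw [← Nat.mul_succ]
        exact Nat.mul_le_mul_left k i.is_lt
      omega
    simp only [crossBit, hP _ hlt, P, decide_eq_true_eq]
    constructor
    · exact fun h => Or.inr ⟨_, h, rfl⟩
    · rintro (⟨h, -⟩ | ⟨⟨i', j'⟩, h, h'⟩)
      · omega
      · dsimp only at h'
        -- The position of a cross-edge bit determines its row by division by `k`, and then its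
        -- column.
        have h1 : (k * i'.val + j') / k = (k * i.val + j) / k := by congr 1; omega
        have hk0 : 0 < k := i.pos
        rw [Nat.mul_add_div hk0, Nat.mul_add_div hk0, Nat.div_eq_of_lt j.is_lt,
          Nat.div_eq_of_lt j'.is_lt] at h1
        have hi : i' = i := Fin.ext (by omega)
        subst hi
        have hj : j' = j := Fin.ext (by omega)
        rwa [hj] at h
  have hN' : N = (ofCode k c).nodeGraph := by
    ext i j
    exact hN i j
  have hC' : C = (ofCode k c).cross := Set.ext hC
  rw [hN', hC']
  rfl

/-- The directed graph with the given list of edges. -/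
def ofEdges {n : ℕ} (E : List (Fin n × Fin n)) : Digraph (Fin n) :=
  ⟨fun u v => (u, v) ∈ E⟩

/-- Adjacency in the graph that the gadget with code `c` yields. -/
def applyBit (c : ℕ) {n k : ℕ} (E : List (Fin n × Fin n)) (p q : Fin n × Fin k) : Bool :=
  (p.1 == q.1 && nodeBit c p.2 q.2) || (E.contains (p.1, q.1) && crossBit c p.2 q.2) ||
    (E.contains (q.1, p.1) && crossBit c q.2 p.2)

theorem apply_ofCode_adj {c n k : ℕ} {E : List (Fin n × Fin n)} (hE : Loopless (ofEdges E))
    {p q : Fin n × Fin k} :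
    ((ofCode k c).apply (ofEdges E)).Adj p q ↔ applyBit c E p q = true := by
  refine NodeGadget.apply_adj.trans ?_
  have h1 : (p.1 = q.1 ∧ nodeBit c p.2 q.2 = true) ↔ (q.1 = p.1 ∧ nodeBit c q.2 p.2 = true) := by
    rw [nodeBit_comm, eq_comm]
  have h2 : (p.1 = q.1 ∧ nodeBit c p.2 q.2 = true) → p ≠ q := by
    rintro ⟨-, h⟩ rfl
    simp [nodeBit] at h
  have h3 : (p.1, q.1) ∈ E → p ≠ q := by
    rintro h rfl
    exact hE _ h
  have h4 : (q.1, p.1) ∈ E → p ≠ q := by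
    rintro h rfl
    exact hE _ h
  simp only [applyBit, Bool.or_eq_true, Bool.and_eq_true, beq_iff_eq, List.contains_iff_mem]
  constructor
  · rintro ⟨-, (h | h) | (h | h)⟩
    · exact Or.inl (Or.inl h)
    · exact Or.inl (Or.inr h)
    · exact Or.inl (Or.inl (h1.mpr h))
    · exact Or.inr h
  · rintro ((h | h) | h)
    · exact ⟨h2 h, Or.inl (Or.inl h)⟩
    · exact ⟨h3 h.1, Or.inl (Or.inr h)⟩
    · exact ⟨h4 h.1, Or.inr (Or.inr h)⟩

theorem hasUndirectedHamCycle_ofCode_iff {c n k : ℕ} {E : List (Fin n × Fin n)}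
    (hE : Loopless (ofEdges E)) :
    HasUndirectedHamCycle ((ofCode k c).apply (ofEdges E)) ↔
      3 ≤ n * k ∧ HasDirectedHamCycle
        (⟨fun p q => applyBit c E p q⟩ : Digraph (Fin n × Fin k)) := by
  rw [hasUndirectedHamCycle_iff]
  have h1 : Nat.card (Fin n × Fin (ofCode k c).k) = n * k := by simp [ofCode]
  have h2 : (⟨((ofCode k c).apply (ofEdges E)).Adj⟩ : Digraph (Fin n × Fin k)) =
      ⟨fun p q => applyBit c E p q⟩ := by
    congr 1
    ext p q
    exact apply_ofCode_adj hE
  rw [h1]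
  exact and_congr_right fun _ => by rw [← h2]; rfl

/-- The hypothesis says that the bits of `m` are among those of `c`. More bits give more edges, so
one cycle for `m` refutes all such `c`. -/
theorem applyBit_mono {m c n k : ℕ} (h : c &&& m = m) (E : List (Fin n × Fin n))
    {p q : Fin n × Fin k} (hm : applyBit m E p q = true) : applyBit c E p q = true := by
  have hb : ∀ b, m.testBit b = true → c.testBit b = true := by
    intro b hb
    rw [← h, Nat.testBit_and, Bool.and_eq_true] at hb
    exact hb.1
  simp only [applyBit, nodeBit, crossBit, Bool.or_eq_true, Bool.and_eq_true] at hm ⊢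
  exact hm.imp (Or.imp (And.imp_right (And.imp_right (hb _))) (And.imp_right (hb _)))
    (And.imp_right (hb _))

/-! ## The counterexamples -/

/-- The edges of the directed cycle of length two. -/
def twoCycleEdges : List (Fin 2 × Fin 2) := [(0, 1), (1, 0)]

/-- The edges of a directed graph on four nodes without a Hamiltonian cycle. -/
def fourNodeEdges : List (Fin 4 × Fin 4) :=
  [(0, 1), (0, 3), (1, 2), (1, 3), (2, 0), (2, 1), (3, 0)]

/-- The directed graph with one node. -/
def point : FiniteDigraph := ⟨1, ofEdges [], by simp [Loopless, ofEdges]⟩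

/-- The directed cycle of length two. -/
def twoCycle : FiniteDigraph :=
  ⟨2, ofEdges twoCycleEdges, by simp [Loopless, ofEdges, twoCycleEdges, Fin.forall_fin_two]⟩

/-- A directed graph on four nodes without a Hamiltonian cycle. -/
def fourNode : FiniteDigraph :=
  ⟨4, ofEdges fourNodeEdges, fun v => by
    change ¬ (v, v) ∈ fourNodeEdges
    revert v
    decide⟩

theorem hasDirectedHamCycle_twoCycle : HasDirectedHamCycle twoCycle.graph :=
  ⟨1, Equiv.refl _, fun i => by
    change (i, i + 1) ∈ twoCycleEdges
    revert i
    decide⟩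

/-- Node 2 can be entered only from 1, so 3 would have to be entered from 0; but the only edge out
of 3 leads back to 0. -/
theorem not_hasDirectedHamCycle_fourNode : ¬ HasDirectedHamCycle fourNode.graph := by
  have h := not_hasDirectedHamCycle_of_pathSearch (A := fun u v => fourNodeEdges.contains (u, v))
    (List.finRange 4) (List.nodup_finRange 4) (List.mem_finRange) 0 (by decide +kernel)
  simpa [fourNode, ofEdges] using h

theorem not_hasDirectedHamCycle_point : ¬ HasDirectedHamCycle point.graph :=
  have : Subsingleton (Fin point.n) := inferInstanceAs (Subsingleton (Fin 1))
  not_hasDirectedHamCycle_of_subsingleton point.loopless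

/-- The resulting graph has `2 * k ≤ 2` nodes, too few for an undirected cycle. -/
theorem not_correctOn_twoCycle_of_lt {k c : ℕ} (hk : k < 2) :
    ¬ (ofCode k c).CorrectOn twoCycle.graph := fun h => by
  have := ((hasUndirectedHamCycle_ofCode_iff twoCycle.loopless).mp
    (h.mp hasDirectedHamCycle_twoCycle)).1
  change 3 ≤ 2 * k at this
  omega

theorem not_correctOn_twoCycle {k c : ℕ} (a : Fin 2 × Fin k) (r : List (Fin 2 × Fin k))
    (hnd : r.Nodup) (hr : ∀ x, x ∈ r)
    (h : pathSearch (applyBit c twoCycleEdges) a r.length a r = false) :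
    ¬ (ofCode k c).CorrectOn twoCycle.graph := fun hc =>
  not_hasDirectedHamCycle_of_pathSearch r hnd hr a h
    ((hasUndirectedHamCycle_ofCode_iff twoCycle.loopless).mp
      (hc.mp hasDirectedHamCycle_twoCycle)).2

theorem not_correctOn_fourNode {k c m : ℕ} (hk : 0 < k) {a : Fin 4 × Fin k}
    {t : List (Fin 4 × Fin k)} (h : IsHamList (applyBit m fourNodeEdges) a t)
    (hm : c &&& m = m) : ¬ (ofCode k c).CorrectOn fourNode.graph := fun hc =>
  not_hasDirectedHamCycle_fourNode <| hc.mpr <|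
    (hasUndirectedHamCycle_ofCode_iff fourNode.loopless).mpr
      ⟨show 3 ≤ 4 * k by omega, h.hasDirectedHamCycle.of_iso (Equiv.refl _) fun _ _ =>
        applyBit_mono hm fourNodeEdges⟩

/-- The mask 7 makes the node graph a triangle, which is by itself a Hamiltonian cycle of the image
of a single node. -/
theorem not_correctOn_point {c : ℕ} (h : c &&& 7 = 7) :
    ¬ (ofCode 3 c).CorrectOn point.graph := fun hc => by
  have hl : IsHamList (applyBit 7 ([] : List (Fin 1 × Fin 1))) ((0, 0) : Fin 1 × Fin 3)
      [(0, 1), (0, 2)] := by decide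
  exact not_hasDirectedHamCycle_point <| hc.mpr <|
    (hasUndirectedHamCycle_ofCode_iff point.loopless).mpr
      ⟨le_rfl, hl.hasDirectedHamCycle.of_iso (Equiv.refl _) fun _ _ => applyBit_mono h []⟩

/-! ## Exhaustive check -/

/-- The permutations of two nodes. -/
def perms2 : List (Equiv.Perm (Fin 2)) :=
  [1, Equiv.swap 0 1]

/-- The permutations of three nodes. -/
def perms3 : List (Equiv.Perm (Fin 3)) :=
  [1, Equiv.swap 0 1, Equiv.swap 0 2, Equiv.swap 1 2, Equiv.swap 0 1 * Equiv.swap 1 2,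
    Equiv.swap 1 2 * Equiv.swap 0 1]

/-- Hamiltonian cycles in graphs that gadgets with two nodes yield from `fourNode`. -/
def hamCycles2 : List ((Fin 4 × Fin 2) × List (Fin 4 × Fin 2)) :=
  [((0, 0), [(0, 1), (3, 0), (3, 1), (1, 0), (2, 1), (2, 0), (1, 1)]),
   ((0, 0), [(2, 0), (0, 1), (2, 1), (1, 1), (3, 1), (1, 0), (3, 0)]),
   ((0, 0), [(0, 1), (2, 1), (1, 1), (3, 1), (3, 0), (1, 0), (2, 0)])]

/-- Hamiltonian cycles in graphs that gadgets with three nodes yield from `fourNode`. -/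
def hamCycles3 : List ((Fin 4 × Fin 3) × List (Fin 4 × Fin 3)) :=
  [((0, 0), [(3, 1), (0, 2), (3, 0), (0, 1), (2, 0), (1, 2), (2, 1), (1, 0), (2, 2), (1, 1),
      (3, 2)]),
   ((0, 0), [(1, 2), (2, 0), (0, 2), (3, 0), (1, 0), (2, 2), (2, 1), (0, 1), (1, 1), (3, 1),
      (3, 2)]),
   ((0, 0), [(2, 0), (1, 0), (2, 2), (2, 1), (0, 1), (0, 2), (3, 0), (1, 2), (1, 1), (3, 1),
      (3, 2)]),
   ((0, 0), [(0, 1), (0, 2), (2, 0), (1, 2), (1, 1), (3, 0), (3, 1), (3, 2), (1, 0), (2, 2),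
      (2, 1)]),
   ((0, 0), [(2, 0), (1, 0), (2, 2), (1, 1), (2, 1), (1, 2), (3, 0), (0, 2), (3, 1), (0, 1),
      (3, 2)]),
   ((0, 0), [(0, 2), (0, 1), (1, 0), (2, 1), (2, 2), (2, 0), (1, 2), (1, 1), (3, 0), (3, 2),
      (3, 1)]),
   ((0, 0), [(2, 2), (1, 0), (2, 1), (1, 2), (2, 0), (1, 1), (3, 2), (0, 1), (3, 0), (0, 2),
      (3, 1)]),
   ((0, 0), [(0, 1), (0, 2), (3, 0), (3, 1), (3, 2), (1, 0), (2, 2), (2, 1), (2, 0), (1, 1),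
      (1, 2)]),
   ((0, 0), [(0, 1), (1, 2), (1, 0), (1, 1), (2, 2), (2, 0), (2, 1), (0, 2), (3, 1), (3, 0),
      (3, 2)]),
   ((0, 0), [(0, 2), (0, 1), (2, 0), (2, 2), (2, 1), (1, 0), (1, 2), (1, 1), (3, 0), (3, 2),
      (3, 1)]),
   ((0, 0), [(0, 2), (0, 1), (2, 1), (2, 2), (2, 0), (1, 0), (1, 2), (1, 1), (3, 1), (3, 2),
      (3, 0)]),
   ((0, 0), [(2, 0), (1, 2), (2, 1), (0, 1), (3, 1), (0, 2), (3, 0), (1, 0), (2, 2), (1, 1),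
      (3, 2)]),
   ((0, 0), [(2, 0), (1, 0), (2, 2), (1, 1), (2, 1), (1, 2), (3, 0), (0, 2), (3, 1),
      (0, 1), (3, 2)]),
   ((0, 0), [(0, 1), (0, 2), (3, 0), (3, 1), (1, 1), (1, 2), (2, 0), (2, 1), (2, 2), (1, 0),
      (3, 2)])]

/-- Codes of gadgets with two nodes that yield a Hamiltonian graph from `fourNode`. -/
def hamCodes2 : List ℕ :=
  [17, 33, 73, 88, 104]

/-- Codes of gadgets with three nodes that yield a Hamiltonian graph from `fourNode`. -/
def hamCodes3 : List ℕ :=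
  [304, 352, 784, 832, 1072, 1120, 1552, 1600, 53, 54, 86, 101, 102, 142, 165, 172, 267, 275, 278,
    291, 293, 323, 326, 394, 424, 533, 534, 549, 581, 582, 645, 652, 771, 773, 904, 1035, 1043,
    1046, 1059, 1061, 1091, 1094, 1162, 1192, 1283, 1539, 1541, 1672, 2061, 2070, 2076, 2118, 2124,
    2179, 2194, 2209, 2224, 2242, 2272, 2313, 2328, 2376, 2689, 2704, 2752, 3081, 3096, 3144]

/-- The codes of the six valid gadgets and their relabellings. -/
def validCodes : List ℕ :=
  [22, 30, 37, 45, 70, 78, 150, 198, 259, 387, 517, 525, 1027, 1155, 2085, 2307, 2565, 3075]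

theorem exists_isHamList2 : ∀ m ∈ hamCodes2, ∃ w ∈ hamCycles2, ∃ e ∈ perms2,
    IsHamList (applyBit m fourNodeEdges) (w.1.map id e) (w.2.map (Prod.map id e)) := by
  decide +kernel

/-- A relabelling carries cycles to cycles, so a stored cycle may serve several codes, after a
permutation of the nodes within the copies. -/
theorem exists_isHamList3 : ∀ m ∈ hamCodes3, ∃ w ∈ hamCycles3, ∃ e ∈ perms3,
    IsHamList (applyBit m fourNodeEdges) (w.1.map id e) (w.2.map (Prod.map id e)) := by
  decide +kernel

/-- The bits of 5 are the path 0 - 1 - 2. The three representatives add bit 9, the cross-edge (2,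
0); bits 3 and 9, that is (0, 0) and (2, 0); bits 3 and 5, that is (0, 0) and (0, 2). -/
theorem exists_iso_of_mem_validCodes : ∀ c ∈ validCodes, ∃ d ∈ [517, 525, 45], ∃ e ∈ perms3,
    (∀ i j : Fin 3, nodeBit c i j = nodeBit d (e i) (e j)) ∧
      ∀ i j : Fin 3, crossBit c i j = crossBit d (e i) (e j) := by
  decide +kernel

/-- The nodes of the graph that a gadget with `k` nodes yields from `twoCycle`. -/
def twoCycleNodes (k : ℕ) : List (Fin 2 × Fin k) :=
  (List.finRange 2).product (List.finRange k)

theorem hamCodes2_check : ∀ c < 128, hamCodes2.any (fun m => c &&& m == m) ||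
    !pathSearch (applyBit c twoCycleEdges) (0, 0) 4 (0, 0) (twoCycleNodes 2) := by
  decide +kernel

/-- The 4096 codes are written with two digits in base 64, which keeps the recursion over the range
shallow. -/
theorem hamCodes3_check : ∀ a < 64, ∀ b < 64, hamCodes3.any (fun m => (64 * a + b) &&& m == m) ||
    (64 * a + b) &&& 7 == 7 || validCodes.contains (64 * a + b) ||
      !pathSearch (applyBit (64 * a + b) twoCycleEdges) (0, 0) 6 (0, 0) (twoCycleNodes 3) := by
  decide +kernel

/-! ## Classification -/

theorem iso_ofCode {c d : ℕ} {k : ℕ} (e : Equiv.Perm (Fin k))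
    (h1 : ∀ i j : Fin k, nodeBit c i j = nodeBit d (e i) (e j))
    (h2 : ∀ i j : Fin k, crossBit c i j = crossBit d (e i) (e j)) :
    (ofCode k c).Iso (ofCode k d) :=
  ⟨e, fun i j => Eq.to_iff (congrArg (· = true) (h1 i j)),
    fun i j => Eq.to_iff (congrArg (· = true) (h2 i j))⟩

theorem ofCode_eq_pathGadget {c : ℕ} {C : Set (Fin 3 × Fin 3)}
    (h1 : ∀ i j : Fin 3, nodeBit c i j = true ↔ (i.val + 1 = j ∨ j.val + 1 = i))
    (h2 : ∀ p : Fin 3 × Fin 3, crossBit c p.1 p.2 = true ↔ p ∈ C) :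
    ofCode 3 c = pathGadget C := by
  have hN : (ofCode 3 c).nodeGraph = SimpleGraph.pathGraph 3 := by
    ext i j
    exact (h1 i j).trans SimpleGraph.pathGraph_adj.symm
  have hC : (ofCode 3 c).cross = C := Set.ext h2
  rw [pathGadget, ← hN, ← hC]
  rfl

theorem ofCode_517 : ofCode 3 517 = pathGadget {(2, 0)} :=
  ofCode_eq_pathGadget (by decide) (by simp only [Set.mem_singleton_iff]; decide)

theorem ofCode_525 : ofCode 3 525 = pathGadget {(0, 0), (2, 0)} :=
  ofCode_eq_pathGadget (by decide)
    (by simp only [Set.mem_insert_iff, Set.mem_singleton_iff]; decide)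

theorem ofCode_45 : ofCode 3 45 = pathGadget {(0, 0), (0, 2)} :=
  ofCode_eq_pathGadget (by decide)
    (by simp only [Set.mem_insert_iff, Set.mem_singleton_iff]; decide)

theorem exists_iso_sixGadgets_of_mem_validCodes {c : ℕ} (hc : c ∈ validCodes) :
    ∃ h ∈ sixGadgets, (ofCode 3 c).Iso h := by
  obtain ⟨d, hd, e, -, h1, h2⟩ := exists_iso_of_mem_validCodes c hc
  refine ⟨ofCode 3 d, ?_, iso_ofCode e h1 h2⟩
  simp only [List.mem_cons, List.not_mem_nil, or_false] at hd
  rcases hd with rfl | rfl | rfl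
  · simp [ofCode_517, sixGadgets]
  · simp [ofCode_525, sixGadgets]
  · simp [ofCode_45, sixGadgets]

theorem mem_twoCycleNodes {k : ℕ} (x : Fin 2 × Fin k) : x ∈ twoCycleNodes k := by
  simp [twoCycleNodes, List.product]

theorem nodup_twoCycleNodes (k : ℕ) : (twoCycleNodes k).Nodup :=
  (List.nodup_finRange 2).product (List.nodup_finRange k)

theorem exists_not_correctOn_two {c : ℕ} (hc : c < 128) :
    ∃ G : FiniteDigraph, ¬ (ofCode 2 c).CorrectOn G.graph := by
  have h := hamCodes2_check c hc
  rw [Bool.or_eq_true, List.any_eq_true, Bool.not_eq_true'] at h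
  rcases h with ⟨m, hm, h⟩ | h
  · obtain ⟨w, -, e, -, hw⟩ := exists_isHamList2 m hm
    exact ⟨fourNode, not_correctOn_fourNode (by omega) hw (by simpa using h)⟩
  · exact ⟨twoCycle, not_correctOn_twoCycle _ _ (nodup_twoCycleNodes 2) mem_twoCycleNodes h⟩

theorem exists_not_correctOn_three {c : ℕ} (hc : c < 4096) (hv : c ∉ validCodes) :
    ∃ G : FiniteDigraph, ¬ (ofCode 3 c).CorrectOn G.graph := by
  have h := hamCodes3_check (c / 64) (by omega) (c % 64) (by omega)
  rw [Nat.div_add_mod] at h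
  simp only [Bool.or_eq_true, List.any_eq_true, Bool.not_eq_true', List.contains_iff_mem, hv,
    or_false] at h
  rcases h with (⟨m, hm, h⟩ | h) | h
  · obtain ⟨w, -, e, -, hw⟩ := exists_isHamList3 m hm
    exact ⟨fourNode, not_correctOn_fourNode (by omega) hw (by simpa using h)⟩
  · exact ⟨point, not_correctOn_point (by simpa using h)⟩
  · exact ⟨twoCycle, not_correctOn_twoCycle _ _ (nodup_twoCycleNodes 3) mem_twoCycleNodes h⟩

theorem exists_iso_or_exists_not_correctOn (g : NodeGadget) (hk : g.k ≤ 3) :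
    (∃ h ∈ sixGadgets, g.Iso h) ∨ ∃ G : FiniteDigraph, ¬ g.CorrectOn G.graph := by
  obtain ⟨c, hc, hg⟩ := exists_eq_ofCode g hk
  generalize g.k = k at hk hc hg
  subst hg
  rcases Nat.lt_or_ge k 2 with h | h
  · exact Or.inr ⟨twoCycle, not_correctOn_twoCycle_of_lt h⟩
  obtain rfl | rfl : k = 2 ∨ k = 3 := by omega
  · exact Or.inr (exists_not_correctOn_two hc)
  · by_cases hv : c ∈ validCodes
    · exact Or.inl (exists_iso_sixGadgets_of_mem_validCodes hv)
    · exact Or.inr (exists_not_correctOn_three hc hv)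

theorem isReduction_of_mem_threeGadgets {h : NodeGadget} (hh : h ∈ threeGadgets) :
    h.IsReduction := by
  have h2 : (pathGadget {(0, 0), (2, 0)}).IsReduction := isReduction_pathGadget (by simp) le_rfl
  rcases hh with rfl | rfl | rfl
  · exact isReduction_pathGadget rfl (by simp)
  · exact h2
  · have hs : (pathGadget {(0, 0), (2, 0)}).swap = pathGadget {(0, 0), (0, 2)} := by
      have : {p : Fin 3 × Fin 3 | (p.2, p.1) ∈ ({(0, 0), (2, 0)} : Set (Fin 3 × Fin 3))} =
          {(0, 0), (0, 2)} := by
        ext ⟨i, j⟩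
        simp [and_comm]
      rw [pathGadget, ← this]
      rfl
    exact hs ▸ h2.swap

theorem isReduction_of_symmetric {g h : NodeGadget} (hh : h ∈ threeGadgets)
    (i : g.Symmetric h) : g.IsReduction := by
  have hr := isReduction_of_mem_threeGadgets hh
  rcases i with i | i
  · exact i.isReduction hr
  · exact (i.isReduction hr).swap

theorem pathGadget_iso_of_rev {C D : Set (Fin 3 × Fin 3)}
    (h : ∀ p, p ∈ C ↔ (Fin.rev p.1, Fin.rev p.2) ∈ D) : (pathGadget C).Iso (pathGadget D) := by
  refine ⟨Fin.revPerm, fun i j => ?_, fun i j => h (i, j)⟩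
  change (SimpleGraph.pathGraph 3).Adj i j ↔ (SimpleGraph.pathGraph 3).Adj (Fin.rev i) (Fin.rev j)
  refine SimpleGraph.pathGraph_adj.trans (Iff.trans ?_ SimpleGraph.pathGraph_adj.symm)
  revert i j
  change ∀ i j : Fin 3, _
  decide

/-- Reversing the path pairs off the six gadgets, so relabelling alone suffices here. -/
theorem exists_iso_threeGadgets {h : NodeGadget} (hh : h ∈ sixGadgets) :
    ∃ l ∈ threeGadgets, h.Iso l := by
  rcases hh with rfl | rfl | rfl | rfl | rfl | rfl
  · exact ⟨_, Or.inl rfl, Equiv.refl _, fun _ _ => Iff.rfl, fun _ _ => Iff.rfl⟩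
  · refine ⟨_, Or.inl rfl, pathGadget_iso_of_rev ?_⟩
    simp only [Set.mem_singleton_iff]
    decide
  · exact ⟨_, Or.inr (Or.inl rfl), Equiv.refl _, fun _ _ => Iff.rfl, fun _ _ => Iff.rfl⟩
  · exact ⟨_, Or.inr (Or.inr rfl), Equiv.refl _, fun _ _ => Iff.rfl, fun _ _ => Iff.rfl⟩
  · refine ⟨_, Or.inr (Or.inl rfl), pathGadget_iso_of_rev ?_⟩
    simp only [Set.mem_insert_iff, Set.mem_singleton_iff]
    decide
  · refine ⟨_, Or.inr (Or.inr rfl), pathGadget_iso_of_rev ?_⟩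
    simp only [Set.mem_insert_iff, Set.mem_singleton_iff]
    decide

theorem isReduction_tfae (g : NodeGadget) (hk : g.k ≤ 3) :
    List.TFAE
      [g.IsReduction, ∃ h ∈ sixGadgets, g.Iso h, ∃ h ∈ threeGadgets, g.Symmetric h] := by
  tfae_have 1 → 2 := fun hg => by
    rcases exists_iso_or_exists_not_correctOn g hk with h | ⟨G, hG⟩
    · exact h
    · exact absurd (hg _ G.graph G.loopless) hG
  tfae_have 2 → 3 := fun ⟨h, hh, i⟩ => by
    obtain ⟨l, hl, j⟩ := exists_iso_threeGadgets hh
    exact ⟨l, hl, Or.inl (i.trans j)⟩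
  tfae_have 3 → 1 := fun ⟨_, hh, i⟩ => isReduction_of_symmetric hh i
  tfae_finish

/-! ## Computing a counterexample -/

theorem replicate_append_false_inj {m n : ℕ} {s t : List Bool}
    (h : List.replicate m true ++ false :: s = List.replicate n true ++ false :: t) :
    m = n ∧ s = t := by
  induction m generalizing n with
  | zero => cases n <;> simp_all [List.replicate_succ]
  | succ m ih =>
    cases n with
    | zero => simp [List.replicate_succ] at h
    | succ n =>
      simp only [List.replicate_succ, List.cons_append, List.cons.injEq, true_and] at h
      simpa using ih h

theorem length_encodeTable {n : ℕ} (R : Fin n → Fin n → Prop) :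
    (encodeTable R).length = n * n := by
  simp [encodeTable, List.length_flatMap]

theorem encodeTable_injective {n : ℕ} {R S : Fin n → Fin n → Prop}
    (h : encodeTable R = encodeTable S) : R = S := by
  classical
  have key : ∀ l : List (Fin n),
      (l.flatMap fun i => (List.finRange n).map fun j => decide (R i j)) =
        (l.flatMap fun i => (List.finRange n).map fun j => decide (S i j)) →
      ∀ i ∈ l, ∀ j, R i j ↔ S i j := by
    intro l
    induction l with
    | nil => simp
    | cons a l ih =>
      intro h
      simp only [List.flatMap_cons] at h
      obtain ⟨h1, h2⟩ := List.append_inj h (by simp)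
      intro i hi j
      rcases List.mem_cons.mp hi with rfl | hi
      · have := List.map_inj_left.mp h1 j (List.mem_finRange j)
        simpa using this
      · exact ih h2 i hi j
  ext i j
  refine key (List.finRange n) ?_ i (List.mem_finRange i) j
  convert h using 1 <;> unfold encodeTable <;> congr!

theorem encodeGadget_injective : Function.Injective encodeGadget := by
  rintro ⟨⟨k, N, C⟩, hk⟩ ⟨⟨l, N', C'⟩, hl⟩ h
  simp only [encodeGadget, List.append_assoc, List.cons_append, List.nil_append] at h
  obtain ⟨rfl, h⟩ := replicate_append_false_inj h
  obtain ⟨h1, h2⟩ := List.append_inj h (by rw [length_encodeTable, length_encodeTable])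
  have hN : N = N' := SimpleGraph.ext (encodeTable_injective h1)
  have hC : C = C' := by
    ext ⟨i, j⟩
    exact iff_of_eq (congrFun (congrFun (encodeTable_injective h2) i) j)
  subst hN hC
  rfl

/-- The extreme case is `k = 3`, with 3 + 1 + 9 + 9 letters. -/
theorem length_encodeGadget_le (g : SmallGadget) : (encodeGadget g).length ≤ 22 := by
  obtain ⟨⟨k, N, C⟩, hk⟩ := g
  simp only [encodeGadget, List.length_append, length_encodeTable, List.length_replicate,
    List.length_singleton]
  dsimp only at hk
  have := Nat.mul_le_mul hk hk
  omega

open Turing in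
/-- Pushes the given word onto the stack, such that its first letter ends up on top, and halts. -/
def writeStmt : List Bool → TM2.Stmt (fun _ : Unit => Bool) Unit (Option Bool)
  | w => w.reverse.foldr (fun b q => .push () (fun _ => b) q) (.load (fun _ => none) .halt)

open Turing in
/-- Pops the whole stack, if it holds at most `n` letters, and writes the image under `F` of the
word that was on it, preceded by `acc`. -/
def readStmt (F : List Bool → List Bool) :
    ℕ → List Bool → TM2.Stmt (fun _ : Unit => Bool) Unit (Option Bool)
  | 0, acc => writeStmt (F acc)
  | n + 1, acc =>
    .pop () (fun _ o => o) <| .branch Option.isNone (writeStmt (F acc)) <|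
      .branch (· == some true) (readStmt F n (acc ++ [true])) (readStmt F n (acc ++ [false]))

open Turing in
theorem stepAux_writeStmt (w : List Bool) (v : Option Bool) :
    TM2.stepAux (writeStmt w) v (fun _ => []) = ⟨none, none, fun _ => w⟩ := by
  have key : ∀ (u r : List Bool) (v : Option Bool),
      TM2.stepAux (u.foldr (fun b q => TM2.Stmt.push () (fun _ => b) q)
        (.load (fun _ => none) .halt) : TM2.Stmt (fun _ : Unit => Bool) Unit (Option Bool)) v
          (fun _ => r) = ⟨none, none, fun _ => u.reverse ++ r⟩ := by
    intro u
    induction u with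
    | nil => intro r v; rfl
    | cons b u ih =>
      intro r v
      have hup : Function.update (fun _ : Unit => r) () (b :: r) = fun _ => b :: r :=
        funext fun _ => rfl
      simp only [List.foldr_cons, TM2.stepAux]
      rw [hup, ih]
      simp
  rw [writeStmt, key]
  simp

open Turing in
theorem stepAux_readStmt (F : List Bool → List Bool) (n : ℕ) :
    ∀ (acc w : List Bool) (v : Option Bool), w.length ≤ n →
      TM2.stepAux (readStmt F n acc) v (fun _ => w) = ⟨none, none, fun _ => F (acc ++ w)⟩ := by
  induction n with
  | zero =>
    intro acc w v hw
    -- With no reads left the stack is already empty, so no further pop is needed to detect its end.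
    obtain rfl : w = [] := by simpa using hw
    simp [readStmt, stepAux_writeStmt]
  | succ n ih =>
    intro acc w v hw
    have hup : ∀ t : List Bool, Function.update (fun _ : Unit => w) () t = fun _ => t :=
      fun t => funext fun _ => rfl
    simp only [readStmt, TM2.stepAux, hup]
    rcases w with _ | ⟨b, w⟩
    · simp [stepAux_writeStmt]
    · have hw' : w.length ≤ n := by simpa using hw
      cases b <;> simp [ih _ _ _ hw']

open Turing in
/-- The machine that computes `F` on the words of length at most `n`. -/
def tableMachine (F : List Bool → List Bool) (n : ℕ) : FinTM2 where
  K := Unit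
  k₀ := ()
  k₁ := ()
  Γ _ := Bool
  Λ := Unit
  main := ()
  σ := Option Bool
  initialState := none
  Γk₀Fin := inferInstanceAs (Fintype Bool)
  m _ := readStmt F n []

open Turing in
/-- A function on encodings of bounded length is computable in polynomial time. -/
theorem nonempty_computableInPolyTime_of_length_le {α β : Type} {ea : α → List Bool}
    {eb : β → List Bool} {f : α → β} (hea : Function.Injective ea) {n : ℕ}
    (hn : ∀ a, (ea a).length ≤ n) : Nonempty (TM2ComputableInPolyTime ea eb f) := by
  have hF : ∀ a, Function.extend ea (fun a => eb (f a)) (fun _ => []) (ea a) = eb (f a) :=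
    fun a => hea.extend_apply _ _ a
  -- Injectivity of `ea` makes the table on words well defined; words that encode nothing get the
  -- empty output.
  set F := Function.extend ea (fun a => eb (f a)) (fun _ => [])
  refine ⟨{ tm := tableMachine F n
            inputAlphabet := Equiv.refl Bool
            outputAlphabet := Equiv.refl Bool
            time := 1
            outputsFun := fun a => ⟨⟨1, ?_⟩, by simp⟩ }⟩
  have hmap : ∀ l : List Bool, l.map (Equiv.refl Bool).invFun = l := fun l => List.map_id l
  -- The whole decision tree is the statement at a single label, so the machine halts after one step
  -- and the time bound is constant.
  have hstep : (tableMachine F n).step (initList (tableMachine F n) (ea a)) =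
      some (haltList (tableMachine F n) (eb (f a))) := by
    have h := stepAux_readStmt F n [] (ea a) none (hn a)
    rw [List.nil_append, hF] at h
    exact congrArg some h
  exact ((congrArg (fun l => (tableMachine F n).step (initList (tableMachine F n) l))
    (hmap (ea a))).trans hstep).trans
      (congrArg (fun l => some (haltList (tableMachine F n) l)) (hmap (eb (f a)))).symm

end NodeGadgets

theorem mainTheorem10 :
    (∀ g : NodeGadgets.NodeGadget, g.k ≤ 3 →
      List.TFAE
        [g.IsReduction,
         ∃ h ∈ NodeGadgets.sixGadgets, g.Iso h,
         ∃ h ∈ NodeGadgets.threeGadgets, g.Symmetric h]) ∧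
    (∃ counterexample : NodeGadgets.SmallGadget → NodeGadgets.FiniteDigraph,
      Nonempty (Turing.TM2ComputableInPolyTime
        NodeGadgets.encodeGadget NodeGadgets.encodeDigraph counterexample) ∧
      ∀ g : NodeGadgets.SmallGadget, ¬ g.1.IsReduction →
        ¬ g.1.CorrectOn (counterexample g).graph) := by
  classical
  refine ⟨NodeGadgets.isReduction_tfae, ?_⟩
  have h : ∀ g : NodeGadgets.SmallGadget, ∃ G : NodeGadgets.FiniteDigraph,
      ¬ g.1.IsReduction → ¬ g.1.CorrectOn G.graph := by
    intro g
    rcases NodeGadgets.exists_iso_or_exists_not_correctOn g.1 g.2 with h | ⟨G, hG⟩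
    -- For a valid gadget any output will do; `point` is a default value.
    · exact ⟨NodeGadgets.point, fun hg =>
        absurd (((NodeGadgets.isReduction_tfae g.1 g.2).out 0 1).mpr h) hg⟩
    · exact ⟨G, fun _ => hG⟩
  choose counterexample hc using h
  exact ⟨counterexample, NodeGadgets.nonempty_computableInPolyTime_of_length_le
    NodeGadgets.encodeGadget_injective NodeGadgets.length_encodeGadget_le, hc⟩
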